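/- Let $\Delta$ be a simply-laced (type ADE, i.e. finite, crystallographic, reduced, with all off-diagonal entries of the Cartan matrix in $\{0,-1\}$) root system with simple roots $\{\alpha_i\}_{i\in I}$. Identify $\mathbb{Z}^I$ with the root lattice via $v\mapsto\sum_{i\in I} v_i\alpha_i$, let $\Delta^+\subset\mathbb{Z}^I$ be the set of positive roots, and let $Q$ be any orientation of the Dynkin diagram. Define the Euler form $$\langle v,w\rangle=\sum_{i\in I}v_iw_i-\sum_{i\to j \text{ in } Q}v_iw_j ,\qquad v,w\in\mathbb{Z}^I .$$ The Auslander–Reiten quiver of $Q$ has vertex set $\Delta^+$, with an arrow $\alpha\to\beta$ if and only if $\alpha\neq\beta$, $\langle\alpha,\beta\rangle>0$, and every $\gamma\in\Delta^+$ with $\langle\alpha,\gamma\rangle>0$ and $\langle\gamma,\beta\rangle>0$ lies in $\{\alpha,\beta\}$. The Auslander–Reiten order on $\Delta^+$ is defined by: $\alpha>\beta$ if and only if there is a path of positive length from $\alpha$ to $\beta$ in the Auslander–Reiten quiver. Positive roots $\alpha<\beta$ form a minimal pair if $\alpha+\beta\in\Delta^+$ and there are no $\alpha',\beta'\in\Delta^+$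 with $\alpha<\alpha'<\beta'<\beta$ and $\alpha'+\beta'=\alpha+\beta$. **Lemma.** If $\alpha<\beta$ is a minimal pair for the Auslander–Reiten order, then $$\langle\alpha,\beta\rangle=-1\qquad\text{and}\qquad\langle\beta,\alpha\rangle=0 .$$ -/

import Mathlib

namespace ARMinimal

open scoped Classical in
/-- The pairing `⟨v, w⟩ = ∑ i, v i * w i - ∑ over arrows i → j of v i * w j` on `ℤ^I` attached to a
quiver with vertex set `I` and at most one arrow from any vertex to any other, the arrows being
recorded by the relation `arrow`. -/
noncomputable def eulerForm {I : Type*} [Fintype I] (arrow : I → I → Prop) (v w : I → ℤ) : ℤ :=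
  ∑ i, v i * w i - ∑ i, ∑ j, if arrow i j then v i * w j else 0

/-- The set `Δ⁺ ⊆ ℤ^I` of positive roots of a root system `P` relative to the base `b`. Here `I` is
the set of simple roots, and a vector `v ∈ ℤ^I` stands for the element `∑ i, v i • (i-th simple root)`
of the root lattice. -/
def positiveRoots {ι R M N : Type*} [CommRing R] [AddCommGroup M] [Module R M]
    [AddCommGroup N] [Module R N] {P : RootPairing ι R M N} (b : P.Base) : Set (b.support → ℤ) :=
  {v | (∀ i, 0 ≤ v i) ∧ ∃ k : ι, P.root k = ∑ i : b.support, v i • P.root i}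

/-- An orientation of the (simply-laced) Dynkin diagram of a root system with base `b`: for every
pair of adjacent vertices, exactly one of the two possible arrows is chosen, and there are no other
arrows. -/
structure DynkinOrientation {ι R M N : Type*} [CommRing R] [CharZero R] [AddCommGroup M]
    [Module R M] [AddCommGroup N] [Module R N] {P : RootPairing ι R M N} [P.IsCrystallographic]
    (b : P.Base) where
  arrow : b.support → b.support → Prop
  arrow_or_arrow_iff : ∀ i j, (arrow i j ∨ arrow j i) ↔ (i ≠ j ∧ b.cartanMatrix i j ≠ 0)
  asymm : ∀ i j, arrow i j → ¬ arrow j i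

/-- The arrows `α → β` of the Auslander-Reiten quiver, in terms of a set `Δ` of positive roots and
the Euler form `e`. -/
def ARArrow {I : Type*} (Δ : Set (I → ℤ)) (e : (I → ℤ) → (I → ℤ) → ℤ) (α β : I → ℤ) : Prop :=
  α ∈ Δ ∧ β ∈ Δ ∧ α ≠ β ∧ 0 < e α β ∧
    ∀ γ ∈ Δ, 0 < e α γ → 0 < e γ β → γ = α ∨ γ = β

/-- The Auslander-Reiten order: `α < β` if and only if there is a path (of positive length) from `β`
to `α` in the Auslander-Reiten quiver. -/
def ARLt {I : Type*} (Δ : Set (I → ℤ)) (e : (I → ℤ) → (I → ℤ) → ℤ) (α β : I → ℤ) : Prop :=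
  Relation.TransGen (ARArrow Δ e) β α

/-- `α < β` is a minimal pair for the relation `lt` on `Δ`. -/
def IsMinimalPair {I : Type*} (Δ : Set (I → ℤ)) (lt : (I → ℤ) → (I → ℤ) → Prop)
    (α β : I → ℤ) : Prop :=
  α ∈ Δ ∧ β ∈ Δ ∧ lt α β ∧ α + β ∈ Δ ∧
    ¬ ∃ α' ∈ Δ, ∃ β' ∈ Δ, lt α α' ∧ lt α' β' ∧ lt β' β ∧ α' + β' = α + β

end ARMinimal

/-! Write B for the Euler form and γ = α + β. Peeling off simple roots at sinks by reflections ranks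
the positive roots so that distinct x, y with ρ x < ρ y satisfy B x y ≥ 0 and B y x ≤ 0
(`IsTail.exists_rank`). A positive value B x y with x ≠ y then yields a path from x to y: an
intermediate root obstructing the arrow splits the rank gap into smaller ones. So α < β gives B β α
≥ 0, and since γ has norm one, B α β + B β α = -1. It remains to exclude h = B β α > 0.

If h > 0, the vector β + hγ lies in the right perpendicular of γ, so it is a sum of norm-one vectors
in that perpendicular whose pairwise B-values are nonnegative
(`IsEulerForm.exists_perp_decomposition`). This rests on the canonical decomposition of dimension
vectors (`IsEulerForm.hasCanonicalDecomposition`). Averaging over the summands produces one, y, such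
that y and γ - y are roots that pair positively from β and to α (`IsEulerForm.exists_intermediate`).
Ordered by rank, these two roots sum to γ and lie strictly between α and β, against minimality.

The root system enters only at the end, where its positive roots are identified with the nonnegative
vectors of norm one. -/

namespace ARMinimal

open LinearMap (BilinForm)

/-! ### Forms of Euler type, norm-one vectors and reflections at sinks. -/

section EulerForm

variable {I : Type*} [DecidableEq I]

/-- A form on `ℤ^I` of the shape of the Euler form of a quiver, with positive definite
symmetrization. -/
structure IsPositiveForm (B : BilinForm ℤ (I → ℤ)) : Prop where
  diag : ∀ i, B (Pi.single i 1) (Pi.single i 1) = 1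
  offDiag : ∀ i j, i ≠ j → B (Pi.single i 1) (Pi.single j 1) ≤ 0
  pos : ∀ v, v ≠ 0 → 0 < B v v

/-- A form on `ℤ^I` of the shape of the Euler form of a Dynkin quiver. -/
structure IsEulerForm (B : BilinForm ℤ (I → ℤ)) : Prop extends IsPositiveForm B where
  finite : {v | B v v = 1}.Finite

/-- The positive roots of a form: the nonnegative vectors of norm one. -/
def IsPosRoot (B : BilinForm ℤ (I → ℤ)) (v : I → ℤ) : Prop := 0 ≤ v ∧ B v v = 1

/-- The vertex `i` is a sink. -/
def IsSink (B : BilinForm ℤ (I → ℤ)) (i : I) : Prop :=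
  ∀ j, j ≠ i → B (Pi.single i 1) (Pi.single j 1) = 0

/-- The reflection in the `i`-th simple root with respect to the symmetrization of `B`. -/
def simpleReflection (B : BilinForm ℤ (I → ℤ)) (i : I) : (I → ℤ) →ₗ[ℤ] (I → ℤ) :=
  LinearMap.id - (B.flip (Pi.single i 1) + B (Pi.single i 1)).smulRight (Pi.single i 1)

/-- The form `B` read in the coordinates of the simple roots reflected at `i`. -/
def reflectedForm (B : BilinForm ℤ (I → ℤ)) (i : I) : BilinForm ℤ (I → ℤ) :=
  B.compl₁₂ (simpleReflection B i) (simpleReflection B i)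

variable {B : BilinForm ℤ (I → ℤ)} {i : I}

lemma simpleReflection_apply (v : I → ℤ) :
    simpleReflection B i v =
      v - (B v (Pi.single i 1) + B (Pi.single i 1) v) • (Pi.single i 1 : I → ℤ) := by
  simp [simpleReflection]

lemma simpleReflection_apply_of_ne {j : I} (h : j ≠ i) (v : I → ℤ) :
    simpleReflection B i v j = v j := by
  simp [simpleReflection_apply, h]

lemma reflectedForm_apply (v w : I → ℤ) :
    reflectedForm B i v w = B (simpleReflection B i v) (simpleReflection B i w) := rfl

lemma IsPositiveForm.simpleReflection_single (hB : IsPositiveForm B) :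
    simpleReflection B i (Pi.single i 1) = -Pi.single i 1 := by
  rw [simpleReflection_apply, hB.diag]; module

@[simp]
lemma IsPositiveForm.simpleReflection_simpleReflection (hB : IsPositiveForm B) (v : I → ℤ) :
    simpleReflection B i (simpleReflection B i v) = v := by
  have h : simpleReflection B i v =
    v - (B v (Pi.single i 1) + B (Pi.single i 1) v) • (Pi.single i 1 : I → ℤ) :=
    simpleReflection_apply v
  rw [h, map_sub, map_smul, hB.simpleReflection_single, h]; module

lemma IsPositiveForm.simpleReflection_injective (hB : IsPositiveForm B) :
    Function.Injective (simpleReflection B i) :=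
  Function.LeftInverse.injective hB.simpleReflection_simpleReflection

lemma IsPositiveForm.reflectedForm_simpleReflection (hB : IsPositiveForm B) (v w : I → ℤ) :
    reflectedForm B i (simpleReflection B i v) (simpleReflection B i w) = B v w := by
  simp [reflectedForm_apply, hB]

lemma IsPositiveForm.apply_simpleReflection_self (hB : IsPositiveForm B) (v : I → ℤ) :
    B (simpleReflection B i v) (simpleReflection B i v) = B v v := by
  simp only [simpleReflection_apply, map_sub, map_smul, LinearMap.sub_apply, LinearMap.smul_apply,
    smul_eq_mul, hB.diag]
  ring

lemma IsEulerForm.isPosRoot_reflectedForm_iff (hB : IsEulerForm B) {v : I → ℤ} :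
    IsPosRoot (reflectedForm B i) v ↔ IsPosRoot B v := by
  rw [IsPosRoot, IsPosRoot, reflectedForm_apply, hB.apply_simpleReflection_self]

lemma IsPositiveForm.isPosRoot_single (hB : IsPositiveForm B) (i : I) :
    IsPosRoot B (Pi.single i 1) :=
  ⟨Pi.single_nonneg.mpr zero_le_one, hB.diag i⟩

/-- Distinct vectors of norm one have symmetrized pairing at most one. -/
lemma IsPositiveForm.add_apply_le_one (hB : IsPositiveForm B) {x y : I → ℤ} (hx : B x x = 1)
    (hy : B y y = 1) (hxy : x ≠ y) : B x y + B y x ≤ 1 := by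
  have := hB.pos (x - y) (sub_ne_zero.mpr hxy)
  simp only [map_sub, LinearMap.sub_apply] at this
  omega

section Fintype

variable [Fintype I]

lemma eq_sum_single (v : I → ℤ) : v = ∑ i, v i • (Pi.single i 1 : I → ℤ) := by
  ext j
  simp [Finset.sum_apply, Pi.single_apply]

lemma apply_eq_sum_left (B : BilinForm ℤ (I → ℤ)) (v w : I → ℤ) :
    B v w = ∑ i, v i * B (Pi.single i 1) w := by
  conv_lhs => rw [eq_sum_single v]
  simp [LinearMap.sum_apply, -zsmul_eq_mul]

lemma apply_eq_sum_right (B : BilinForm ℤ (I → ℤ)) (v w : I → ℤ) :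
    B v w = ∑ i, w i * B v (Pi.single i 1) := by
  conv_lhs => rw [eq_sum_single w]
  simp [-zsmul_eq_mul]

lemma IsPositiveForm.apply_nonpos_of_disjoint (hB : IsPositiveForm B) {v w : I → ℤ}
    (hv : 0 ≤ v) (hw : 0 ≤ w) (h : ∀ i, v i = 0 ∨ w i = 0) : B v w ≤ 0 := by
  rw [apply_eq_sum_left]
  refine Finset.sum_nonpos fun i _ ↦ ?_
  rcases h i with hi | hi
  · simp [hi]
  refine mul_nonpos_of_nonneg_of_nonpos (hv i) ?_
  rw [apply_eq_sum_right]
  refine Finset.sum_nonpos fun j _ ↦ ?_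
  rcases eq_or_ne i j with rfl | hij
  · simp [hi]
  · exact mul_nonpos_of_nonneg_of_nonpos (hw j) (hB.offDiag i j hij)

lemma IsSink.apply_single_left (hi : IsSink B i) (hB : IsEulerForm B) (v : I → ℤ) :
    B (Pi.single i 1) v = v i := by
  rw [apply_eq_sum_right, Finset.sum_eq_single i]
  · simp [hB.diag]
  · intro j _ hj
    simp [hi j hj]
  · simp

/-- Translates positivity of a reflected root into the sign of its pairing with the sink. -/
lemma IsSink.simpleReflection_apply_self (hi : IsSink B i) (hB : IsEulerForm B) (v : I → ℤ) :
    simpleReflection B i v i = -B v (Pi.single i 1) := by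
  simp [simpleReflection_apply, hi.apply_single_left hB]

/-- The positive and negative parts have disjoint supports, hence pair nonpositively; if both were
nonzero, the norm would be at least 2. -/
lemma IsPositiveForm.nonneg_or_nonpos (hB : IsPositiveForm B) {v : I → ℤ} (hv : B v v = 1) :
    0 ≤ v ∨ v ≤ 0 := by
  by_contra! h
  have hp : v ⊔ 0 ≠ 0 := fun h0 ↦ h.2 (sup_eq_right.mp h0)
  have hn : (-v) ⊔ 0 ≠ 0 := fun h0 ↦ h.1 (neg_nonpos.mp (sup_eq_right.mp h0))
  have hd : ∀ i, (v ⊔ 0) i = 0 ∨ ((-v) ⊔ 0) i = 0 := fun i ↦ by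
    simp only [Pi.sup_apply, Pi.neg_apply, Pi.zero_apply]; omega
  have e : v = v ⊔ 0 - (-v) ⊔ 0 := by
    ext i
    simp only [Pi.sub_apply, Pi.sup_apply, Pi.neg_apply, Pi.zero_apply]; omega
  have h1 := hB.apply_nonpos_of_disjoint (le_sup_right) (le_sup_right) hd
  have h2 := hB.apply_nonpos_of_disjoint (le_sup_right) (le_sup_right) fun i ↦ (hd i).symm
  have h3 := hB.pos _ hp
  have h4 := hB.pos _ hn
  rw [e] at hv
  simp only [map_sub, LinearMap.sub_apply] at hv
  omega

lemma IsPositiveForm.isPosRoot_or_neg (hB : IsPositiveForm B) {v : I → ℤ} (hv : B v v = 1) :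
    IsPosRoot B v ∨ IsPosRoot B (-v) :=
  (hB.nonneg_or_nonpos hv).imp (fun h ↦ ⟨h, hv⟩) fun h ↦ ⟨neg_nonneg.mpr h, by simpa⟩

lemma IsEulerForm.simpleReflection_nonneg (hB : IsEulerForm B) {x : I → ℤ}
    (hx : IsPosRoot B x) (hne : x ≠ Pi.single i 1) : 0 ≤ simpleReflection B i x := by
  have h1 : B (simpleReflection B i x) (simpleReflection B i x) = 1 := by
    rw [hB.apply_simpleReflection_self, hx.2]
  rcases hB.nonneg_or_nonpos h1 with h0 | h0
  · exact h0
  have h1 : ∀ j, j ≠ i → x j = 0 := fun j hj ↦ by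
    have := h0 j
    rw [simpleReflection_apply_of_ne hj] at this
    exact le_antisymm this (hx.1 j)
  have h2 : x = x i • (Pi.single i 1 : I → ℤ) := by
    ext j
    rcases eq_or_ne j i with rfl | hj
    · simp
    · simp [h1 j hj, hj]
  have h3 := hx.2
  rw [h2] at h3
  simp only [map_smul, LinearMap.smul_apply, hB.diag, smul_eq_mul, mul_one] at h3
  have h4 : x i = 1 := by have := hx.1 i; simp only [Pi.zero_apply] at this; nlinarith
  exact absurd (by rw [h2, h4, one_smul]) hne

lemma IsEulerForm.isPosRoot_simpleReflection (hB : IsEulerForm B) {x : I → ℤ}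
    (hx : IsPosRoot B x) (hne : x ≠ Pi.single i 1) : IsPosRoot B (simpleReflection B i x) :=
  ⟨hB.simpleReflection_nonneg hx hne, by rw [hB.apply_simpleReflection_self, hx.2]⟩

-- Reflecting at a sink reverses the arrows into `i` and leaves the other entries unchanged, so the
-- off-diagonal signs survive.
omit [Fintype I] in
lemma IsEulerForm.reflectedForm (hB : IsEulerForm B) (hi : IsSink B i) :
    IsEulerForm (reflectedForm B i) where
  diag j := by rw [reflectedForm_apply, hB.apply_simpleReflection_self, hB.diag]
  offDiag j k hjk := by
    rcases eq_or_ne j i with rfl | hj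
    · have h := hi k hjk.symm
      have h' := hB.offDiag k j hjk.symm
      rw [reflectedForm_apply, hB.simpleReflection_single, simpleReflection_apply]
      simp [h, hB.diag, h', -zsmul_eq_mul]
    · have h := hi j hj
      rcases eq_or_ne k i with rfl | hk
      · rw [reflectedForm_apply, hB.simpleReflection_single, simpleReflection_apply]
        simp [h, hB.diag, -zsmul_eq_mul]
      · have h' := hi k hk
        simp only [reflectedForm_apply, simpleReflection_apply, map_sub, map_smul, smul_eq_mul,
          LinearMap.sub_apply, LinearMap.smul_apply, h, h', hB.diag]
        linarith [hB.offDiag j k hjk]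
  pos v hv := hB.pos _ fun h ↦ hv (hB.simpleReflection_injective (h.trans (map_zero _).symm))
  finite := hB.finite.preimage hB.simpleReflection_injective.injOn

end Fintype

end EulerForm

/-! ### Peeling off positive roots at sinks. -/

section Tail

universe u

variable {I : Type u} [DecidableEq I] {B : BilinForm ℤ (I → ℤ)} {i : I} {S : Set (I → ℤ)}

/-- `S` is a set of positive roots that is final for the order given by the signs of `B`. -/
structure IsTail (B : BilinForm ℤ (I → ℤ)) (S : Set (I → ℤ)) : Prop where
  euler : IsEulerForm B
  isPosRoot : ∀ x ∈ S, IsPosRoot B x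
  order : ∀ x ∈ S, ∀ n, IsPosRoot B n → n ∉ S → B n x ≤ 0 ∧ 0 ≤ B x n

lemma IsEulerForm.isTail (hB : IsEulerForm B) : IsTail B {x | IsPosRoot B x} :=
  ⟨hB, fun _ h ↦ h, fun _ _ _ h h' ↦ absurd h h'⟩

lemma IsTail.finite (h : IsTail B S) : S.Finite :=
  h.euler.finite.subset fun x hx ↦ (h.isPosRoot x hx).2

lemma IsTail.ncard_lt (h : IsTail B S) (hi : Pi.single i 1 ∈ S) :
    (simpleReflection B i '' (S \ {Pi.single i 1})).ncard < S.ncard := by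
  rw [Set.ncard_image_of_injective _ h.euler.simpleReflection_injective]
  exact Set.ncard_sdiff_singleton_lt_of_mem hi h.finite

variable [Fintype I]

/-- Otherwise every simple root in `S` has an arrow to another simple root, again in `S` by the
order condition; following arrows never stops, which positivity of the form forbids. -/
lemma IsTail.exists_isSink (h : IsTail B S) (hS : S.Nonempty) :
    ∃ i, IsSink B i ∧ Pi.single i 1 ∈ S := by
  classical
  have hB := h.euler
  by_contra! hno
  have key : ∀ i, Pi.single i 1 ∈ S →
      ∃ j, j ≠ i ∧ B (Pi.single i 1) (Pi.single j 1) ≤ -1 ∧ Pi.single j 1 ∈ S := by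
    intro i hi
    have h1 : ¬ IsSink B i := fun hs ↦ hno i hs hi
    simp only [IsSink, not_forall] at h1
    obtain ⟨j, hj, hj'⟩ := h1
    have h2 := hB.offDiag i j hj.symm
    refine ⟨j, hj, by omega, ?_⟩
    by_contra hjS
    have := (h.order _ hi _ (hB.isPosRoot_single j) hjS).2
    omega
  -- The indicator of the simple roots in `S`: each of these pairs with `u` to at most 1 - 1 = 0, so
  -- `u` would have norm at most 0.
  let u : I → ℤ := fun i ↦ if Pi.single i 1 ∈ S then 1 else 0
  have hu : ∀ i, 0 ≤ u i := fun i ↦ by simp only [u]; split_ifs <;> norm_num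
  have hu0 : u ≠ 0 := by
    intro hu0
    have hnot : ∀ i, (Pi.single i 1 : I → ℤ) ∉ S := fun i hi ↦ by
      have := congrFun hu0 i
      simp [u, hi] at this
    obtain ⟨x, hx⟩ := hS
    have h1 := (h.isPosRoot x hx).2
    rw [apply_eq_sum_left] at h1
    have h2 : ∑ i, x i * B (Pi.single i 1) x ≤ 0 := Finset.sum_nonpos fun i _ ↦
      mul_nonpos_of_nonneg_of_nonpos ((h.isPosRoot x hx).1 i)
        (h.order x hx _ (hB.isPosRoot_single i) (hnot i)).1
    omega
  have h1 := hB.pos u hu0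
  rw [apply_eq_sum_left] at h1
  refine absurd h1 (not_lt.mpr (Finset.sum_nonpos fun i _ ↦ ?_))
  by_cases hi : Pi.single i 1 ∈ S
  swap
  · simp [u, hi]
  refine mul_nonpos_of_nonneg_of_nonpos (hu i) ?_
  obtain ⟨k, hk, hk1, hkS⟩ := key i hi
  rw [apply_eq_sum_right]
  calc ∑ j, u j * B (Pi.single i 1) (Pi.single j 1)
      ≤ ∑ j, ((if j = i then 1 else 0) - (if j = k then 1 else 0) : ℤ) := by
        refine Finset.sum_le_sum fun j _ ↦ ?_
        rcases eq_or_ne j i with rfl | hj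
        · simp [u, hi, hk.symm, hB.diag]
        rcases eq_or_ne j k with rfl | hjk
        · simp [u, hkS, hk, hk1]
        · simpa [hj, hjk] using
            mul_nonpos_of_nonneg_of_nonpos (hu j) (hB.offDiag i j hj.symm)
    _ = 0 := by simp

lemma IsTail.reflect (h : IsTail B S) (hi : IsSink B i) :
    IsTail (reflectedForm B i) (simpleReflection B i '' (S \ {Pi.single i 1})) where
  euler := h.euler.reflectedForm hi
  isPosRoot := by
    rintro _ ⟨x, ⟨hx, hne⟩, rfl⟩
    exact h.euler.isPosRoot_reflectedForm_iff.mpr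
      (h.euler.isPosRoot_simpleReflection (h.isPosRoot x hx) hne)
  order := by
    rintro _ ⟨x, ⟨hx, hne⟩, rfl⟩ n hn hnS
    have hB := h.euler
    rw [hB.isPosRoot_reflectedForm_iff] at hn
    have e1 := hB.reflectedForm_simpleReflection (i := i) (simpleReflection B i n) x
    have e2 := hB.reflectedForm_simpleReflection (i := i) x (simpleReflection B i n)
    rw [hB.simpleReflection_simpleReflection] at e1 e2
    rw [e1, e2]
    -- In the new coordinates this simple root is the negative of the root just removed; all other
    -- roots outside the new tail come from outside `S`.
    rcases eq_or_ne n (Pi.single i 1) with rfl | hni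
    · rw [hB.simpleReflection_single]
      have h1 := (h.isPosRoot x hx).1 i
      have h2 := hB.simpleReflection_nonneg (h.isPosRoot x hx) hne i
      rw [hi.simpleReflection_apply_self hB] at h2
      simpa [hi.apply_single_left hB] using And.intro h1 h2
    · refine h.order x hx _ (hB.isPosRoot_simpleReflection hn hni) fun hS ↦ hnS ?_
      refine ⟨_, ⟨hS, fun h0 ↦ ?_⟩, hB.simpleReflection_simpleReflection n⟩
      rw [Set.mem_singleton_iff] at h0
      have h1 := hB.simpleReflection_simpleReflection (i := i) n
      rw [h0, hB.simpleReflection_single] at h1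
      have h2 := hn.1 i
      simp [← h1] at h2

/-- The positive roots can be ranked compatibly with the signs of `B`. -/
theorem IsTail.exists_rank (h : IsTail B S) :
    ∃ ρ : (I → ℤ) → ℕ, ∀ x ∈ S, ∀ y ∈ S, x ≠ y →
      ρ x ≠ ρ y ∧ (ρ x < ρ y → 0 ≤ B x y ∧ B y x ≤ 0) := by
  classical
  induction hn : S.ncard using Nat.strong_induction_on generalizing B S with
  | _ n ih =>
    rcases S.eq_empty_or_nonempty with rfl | hS
    · exact ⟨0, by simp⟩
    obtain ⟨i, hi, hiS⟩ := h.exists_isSink hS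
    obtain ⟨ρ, hρ⟩ := ih _ (hn ▸ h.ncard_lt hiS) (h.reflect hi) rfl
    have hB := h.euler
    have hpos : ∀ x ∈ S, x ≠ Pi.single i 1 →
        0 ≤ B (Pi.single i 1) x ∧ B x (Pi.single i 1) ≤ 0 := fun x hx hne ↦ by
      have h1 := (h.isPosRoot x hx).1 i
      have h2 := hB.simpleReflection_nonneg (h.isPosRoot x hx) hne i
      rw [hi.simpleReflection_apply_self hB] at h2
      simpa [hi.apply_single_left hB] using And.intro h1 h2
    -- The sink comes first; the other ranks are inherited from the reflected form and shifted by
    -- one.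
    refine ⟨fun x ↦ if x = Pi.single i 1 then 0 else ρ (simpleReflection B i x) + 1,
      fun x hx y hy hxy ↦ ?_⟩
    by_cases hxi : x = Pi.single i 1
    · subst hxi
      simpa [hxy.symm] using hpos y hy hxy.symm
    by_cases hyi : y = Pi.single i 1
    · subst hyi
      simp [hxi]
    have := hρ _ ⟨x, ⟨hx, hxi⟩, rfl⟩ _ ⟨y, ⟨hy, hyi⟩, rfl⟩
      (hB.simpleReflection_injective.ne hxy)
    simpa [hxi, hyi, hB.reflectedForm_simpleReflection] using this

/-- Every positive root is a simple root at a sink in suitable coordinates. -/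
theorem IsTail.exists_linearEquiv (h : IsTail B S) {γ : I → ℤ} (hγ : γ ∈ S) :
    ∃ (B' : BilinForm ℤ (I → ℤ)) (k : I) (f : (I → ℤ) ≃ₗ[ℤ] (I → ℤ)),
      IsEulerForm B' ∧ IsSink B' k ∧ (∀ v w, B (f v) (f w) = B' v w) ∧ f (Pi.single k 1) = γ := by
  induction hn : S.ncard using Nat.strong_induction_on generalizing B S γ with
  | _ n ih =>
    obtain ⟨i, hi, hiS⟩ := h.exists_isSink ⟨γ, hγ⟩
    rcases eq_or_ne γ (Pi.single i 1) with rfl | hne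
    · exact ⟨B, i, LinearEquiv.refl ℤ _, h.euler, hi, fun _ _ ↦ rfl, rfl⟩
    obtain ⟨B', k, f, hB', hk, hf, hfk⟩ :=
      ih _ (hn ▸ h.ncard_lt hiS) (h.reflect hi) ⟨γ, ⟨hγ, hne⟩, rfl⟩ rfl
    refine ⟨B', k, f.trans (LinearEquiv.ofInvolutive (simpleReflection B i)
      h.euler.simpleReflection_simpleReflection), hB', hk, fun v w ↦ hf v w, ?_⟩
    rw [LinearEquiv.trans_apply, hfk]
    exact h.euler.simpleReflection_simpleReflection γ

end Tail

/-! ### Canonical decomposition of a vector into norm-one vectors. -/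

section Decomposition

universe u

/-- Extension by zero of a vector defined away from `i`. -/
def extendZero {I : Type u} [DecidableEq I] (i : I) : ({j // j ≠ i} → ℤ) →ₗ[ℤ] (I → ℤ) :=
  LinearMap.pi fun j ↦ if h : j ≠ i then LinearMap.proj ⟨j, h⟩ else 0

variable {I : Type u} [DecidableEq I] {B : BilinForm ℤ (I → ℤ)} {i : I} {S : Set (I → ℤ)}

@[simp]
lemma extendZero_apply_self (v : {j // j ≠ i} → ℤ) : extendZero i v i = 0 := by
  simp [extendZero]

@[simp]
lemma extendZero_apply_coe (v : {j // j ≠ i} → ℤ) (j : {j // j ≠ i}) :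
    extendZero i v j = v j := by
  simp [extendZero, j.2]

lemma extendZero_injective : Function.Injective (extendZero i) := fun v w h ↦ by
  ext j
  simpa using congrFun h j

lemma extendZero_single (j : {j // j ≠ i}) :
    extendZero i (Pi.single j 1) = Pi.single (j : I) 1 := by
  ext k
  by_cases hk : k = i
  · subst hk
    simp [j.2.symm]
  · simp [extendZero, hk, Pi.single_apply, Subtype.ext_iff]

lemma IsEulerForm.compl₁₂_extendZero (hB : IsEulerForm B) :
    IsEulerForm (B.compl₁₂ (extendZero i) (extendZero i)) where
  diag j := by simp [extendZero_single, hB.diag]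
  offDiag j k h := by
    simpa [extendZero_single] using hB.offDiag j k fun h' ↦ h (Subtype.ext h')
  pos v hv := hB.pos _ fun h ↦ hv (extendZero_injective (h.trans (map_zero _).symm))
  finite := hB.finite.preimage extendZero_injective.injOn

lemma extendZero_nonneg {v : {j // j ≠ i} → ℤ} (hv : 0 ≤ v) : 0 ≤ extendZero i v := fun j ↦ by
  by_cases hj : j = i
  · subst hj; simp
  · simpa using (extendZero_apply_coe v ⟨j, hj⟩).ge.trans' (hv _)

lemma extendZero_restrict (d : I → ℤ) :
    extendZero i (fun j ↦ d j) = d - d i • (Pi.single i 1 : I → ℤ) := by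
  ext j
  by_cases hj : j = i
  · subst hj; simp
  · simpa [hj] using extendZero_apply_coe (fun j : {j // j ≠ i} ↦ d j) ⟨j, hj⟩

variable [Fintype I]

/-- A decomposition of `d` into positive roots with pairwise nonnegative values of the form. -/
def HasCanonicalDecomposition (B : BilinForm ℤ (I → ℤ)) (d : I → ℤ) : Prop :=
  ∃ l : List (I → ℤ), (∀ x ∈ l, IsPosRoot B x) ∧ (∀ x ∈ l, ∀ y ∈ l, 0 ≤ B x y) ∧ l.sum = d

lemma HasCanonicalDecomposition.of_reflect (hB : IsEulerForm B) (hi : IsSink B i) {d : I → ℤ}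
    (hd : 0 ≤ d)
    (h : HasCanonicalDecomposition (reflectedForm B i) (simpleReflection B i d)) :
    HasCanonicalDecomposition B d := by
  obtain ⟨l, hl, hl', hsum⟩ := h
  -- A summand equal to this simple root would pair with the total to at least 1, but that pairing
  -- is `-d i`.
  have hne : Pi.single i 1 ∉ l := fun hmem ↦ by
    have h1 : reflectedForm B i (Pi.single i 1) l.sum ≤ 0 := by
      rw [hsum, reflectedForm_apply, hB.simpleReflection_simpleReflection,
        hB.simpleReflection_single]
      simpa [hi.apply_single_left hB] using hd i
    rw [map_list_sum] at h1
    have h2 := List.single_le_sum (l := l.map (reflectedForm B i (Pi.single i 1)))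
      (by simpa using fun y hy ↦ hl' _ hmem y hy) _ (List.mem_map_of_mem hmem)
    rw [(hB.reflectedForm hi).diag] at h2
    omega
  refine ⟨l.map (simpleReflection B i), ?_, ?_, ?_⟩
  · simp only [List.mem_map, forall_exists_index, and_imp, forall_apply_eq_imp_iff₂]
    exact fun x hx ↦ hB.isPosRoot_simpleReflection (hB.isPosRoot_reflectedForm_iff.mp (hl x hx))
      fun h ↦ hne (h ▸ hx)
  · simp only [List.mem_map, forall_exists_index, and_imp, forall_apply_eq_imp_iff₂]
    exact fun x hx y hy ↦ hl' x hx y hy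
  · rw [← map_list_sum, hsum, hB.simpleReflection_simpleReflection]

/-- Splits off `B d (Pi.single i 1)` copies of the simple root. The rest is the reflection of `d`
with its `i`-th coordinate erased, so it is decomposed on one vertex fewer, inside the left
perpendicular of the sink. -/
lemma HasCanonicalDecomposition.of_extendZero (hB : IsEulerForm B) (hi : IsSink B i) {d : I → ℤ}
    (ht : 0 ≤ B d (Pi.single i 1))
    (h : HasCanonicalDecomposition
      ((reflectedForm B i).compl₁₂ (extendZero i) (extendZero i)) (fun j ↦ d j)) :
    HasCanonicalDecomposition B d := by
  obtain ⟨l, hl, hl', hsum⟩ := h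
  let g : ({j // j ≠ i} → ℤ) → (I → ℤ) := fun y ↦ simpleReflection B i (extendZero i y)
  have hg : ∀ y, B (g y) (Pi.single i 1) = 0 := fun y ↦ by
    have := hi.simpleReflection_apply_self hB (g y)
    simp only [g, hB.simpleReflection_simpleReflection, extendZero_apply_self] at this ⊢
    omega
  have hroot : ∀ y ∈ l, IsPosRoot B (g y) := fun y hy ↦ by
    refine hB.isPosRoot_simpleReflection (hB.isPosRoot_reflectedForm_iff.mp
      ⟨extendZero_nonneg (hl y hy).1, (hl y hy).2⟩) fun h ↦ ?_
    simpa using congrFun h i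
  have hsum' : (l.map g).sum = d - B d (Pi.single i 1) • (Pi.single i 1 : I → ℤ) := by
    have : (l.map g).sum = ((simpleReflection B i).comp (extendZero i)) l.sum := by
      rw [map_list_sum]; rfl
    rw [this, hsum, LinearMap.comp_apply, extendZero_restrict, map_sub, map_smul,
      hB.simpleReflection_single, simpleReflection_apply, hi.apply_single_left hB]
    module
  refine ⟨l.map g ++ List.replicate (B d (Pi.single i 1)).toNat (Pi.single i 1), ?_, ?_, ?_⟩
  · intro x hx
    rw [List.mem_append, List.mem_map] at hx
    rcases hx with ⟨y, hy, rfl⟩ | hx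
    · exact hroot y hy
    · rw [List.eq_of_mem_replicate hx]
      exact hB.isPosRoot_single i
  · intro x hx y hy
    rw [List.mem_append, List.mem_map] at hx hy
    rcases hx with ⟨x, hx, rfl⟩ | hx <;> rcases hy with ⟨y, hy, rfl⟩ | hy
    · exact hl' x hx y hy
    · rw [List.eq_of_mem_replicate hy, hg]
    · rw [List.eq_of_mem_replicate hx, hi.apply_single_left hB]
      exact (hroot y hy).1 i
    · rw [List.eq_of_mem_replicate hx, List.eq_of_mem_replicate hy, hB.diag]
      exact zero_le_one
  · rw [List.sum_append, hsum', List.sum_replicate, ← natCast_zsmul, Int.toNat_of_nonneg ht,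
      sub_add_cancel]

/-- The unreflected positive roots together with the negatives of the reflected ones. -/
def originalRoots (B : BilinForm ℤ (I → ℤ)) (S : Set (I → ℤ)) : Set (I → ℤ) :=
  S ∪ {x | IsPosRoot B (-x) ∧ -x ∉ S}

lemma image_originalRoots_subset (hB : IsEulerForm B) (hpos : ∀ x ∈ S, IsPosRoot B x)
    (hiS : Pi.single i 1 ∈ S) :
    simpleReflection B i '' originalRoots B S ⊆
      originalRoots (reflectedForm B i) (simpleReflection B i '' (S \ {Pi.single i 1})) := by
  rintro _ ⟨x, hx | ⟨hx, hxS⟩, rfl⟩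
  · by_cases hxi : x = Pi.single i 1
    · subst hxi
      refine Or.inr ?_
      rw [hB.simpleReflection_single, Set.mem_ofPred_eq, neg_neg, hB.isPosRoot_reflectedForm_iff]
      refine ⟨hB.isPosRoot_single i, ?_⟩
      rintro ⟨y, ⟨hy, -⟩, h⟩
      have h1 := (hpos y hy).1 i
      rw [← hB.simpleReflection_simpleReflection (i := i) y, h, hB.simpleReflection_single] at h1
      simp at h1
    · exact Or.inl ⟨x, ⟨hx, hxi⟩, rfl⟩
  · refine Or.inr ?_
    rw [Set.mem_ofPred_eq, ← map_neg, hB.isPosRoot_reflectedForm_iff]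
    refine ⟨hB.isPosRoot_simpleReflection hx fun h ↦ hxS (h ▸ hiS), ?_⟩
    rintro ⟨y, ⟨hy, -⟩, h⟩
    exact hxS (hB.simpleReflection_injective h ▸ hy)

/-- According to the sign of `B d (Pi.single i 1)`, either a vertex is dropped or everything is
reflected and the tail shrinks. Membership of `d` in the cone of original roots ends the recursion:
once the tail is empty, these are all negative, forcing `d = 0`. -/
lemma IsTail.hasCanonicalDecomposition (h : IsTail B S)
    (ih : ∀ (i : I) (B' : BilinForm ℤ ({j // j ≠ i} → ℤ)), IsEulerForm B' →
      ∀ d, 0 ≤ d → HasCanonicalDecomposition B' d)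
    {d : I → ℤ} (hd : 0 ≤ d) (hdS : d ∈ AddSubmonoid.closure (originalRoots B S)) :
    HasCanonicalDecomposition B d := by
  induction hn : S.ncard using Nat.strong_induction_on generalizing B S d with
  | _ n ihn =>
    have hB := h.euler
    rcases S.eq_empty_or_nonempty with rfl | hS
    · have : d ≤ 0 := by
        refine AddSubmonoid.closure_induction (motive := fun x _ ↦ x ≤ 0) ?_ le_rfl
          (fun _ _ _ _ ↦ add_nonpos) hdS
        rintro x (hx | hx)
        · exact absurd hx (Set.notMem_empty x)
        · exact neg_nonneg.mp hx.1.1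
      exact ⟨[], by simp, by simp, le_antisymm hd this⟩
    obtain ⟨i, hi, hiS⟩ := h.exists_isSink hS
    by_cases hdi : 0 ≤ B d (Pi.single i 1)
    · exact .of_extendZero hB hi hdi (ih i _ (hB.reflectedForm hi).compl₁₂_extendZero _
        fun j ↦ hd j)
    refine .of_reflect hB hi hd (ihn _ (hn ▸ h.ncard_lt hiS) (h.reflect hi) ?_ ?_ rfl)
    · intro j
      rcases eq_or_ne j i with rfl | hj
      · rw [hi.simpleReflection_apply_self hB]
        exact (neg_pos.mpr (not_le.mp hdi)).le
      · rw [simpleReflection_apply_of_ne hj]; exact hd j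
    · refine AddSubmonoid.closure_mono (image_originalRoots_subset hB h.isPosRoot hiS) ?_
      have := AddSubmonoid.mem_map_of_mem (simpleReflection B i).toAddMonoidHom hdS
      rw [AddMonoidHom.map_mclosure] at this
      exact this

theorem IsEulerForm.hasCanonicalDecomposition (hB : IsEulerForm B) {d : I → ℤ} (hd : 0 ≤ d) :
    HasCanonicalDecomposition B d := by
  induction hn : Fintype.card I using Nat.strong_induction_on generalizing I with
  | _ n ih =>
    refine hB.isTail.hasCanonicalDecomposition (fun i B' hB' d hd ↦ ih _ ?_ hB' hd rfl) hd ?_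
    · rw [← hn]
      exact Fintype.card_subtype_lt (x := i) (by simp)
    · rw [eq_sum_single d]
      refine sum_mem fun i _ ↦ ?_
      obtain ⟨m, hm⟩ := Int.eq_ofNat_of_zero_le (hd i)
      rw [hm, natCast_zsmul]
      have hmem : Pi.single i 1 ∈ originalRoots B {x | IsPosRoot B x} :=
        Set.mem_union_left _ (hB.isPosRoot_single i)
      exact nsmul_mem (AddSubmonoid.subset_closure hmem) m

/-- Decompose the positive and negative parts separately; their supports are disjoint, so changing
the sign of one side makes the cross terms nonnegative. -/
theorem IsEulerForm.exists_decomposition (hB : IsEulerForm B) (d : I → ℤ) :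
    ∃ l : List (I → ℤ), (∀ x ∈ l, B x x = 1) ∧ (∀ x ∈ l, ∀ i, d i = 0 → x i = 0) ∧
      (∀ x ∈ l, ∀ y ∈ l, 0 ≤ B x y) ∧ l.sum = d := by
  obtain ⟨l, hl, hl', hsum⟩ := hB.hasCanonicalDecomposition (d := d ⊔ 0) le_sup_right
  obtain ⟨m, hm, hm', hsum'⟩ := hB.hasCanonicalDecomposition (d := (-d) ⊔ 0) le_sup_right
  have hle : ∀ (l : List (I → ℤ)), (∀ x ∈ l, IsPosRoot B x) → ∀ x ∈ l, x ≤ l.sum :=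
    fun l hl x hx ↦ List.single_le_sum (fun y hy ↦ (hl y hy).1) x hx
  have h1 : ∀ x ∈ l, ∀ i, d i ≤ 0 → x i = 0 := fun x hx i hi ↦ by
    have h1 := hle l hl x hx i
    have h2 := (hl x hx).1 i
    rw [hsum] at h1
    simp only [Pi.sup_apply, Pi.zero_apply] at h1 h2
    omega
  have h2 : ∀ x ∈ m, ∀ i, 0 ≤ d i → x i = 0 := fun x hx i hi ↦ by
    have h1 := hle m hm x hx i
    have h2 := (hm x hx).1 i
    rw [hsum'] at h1
    simp only [Pi.sup_apply, Pi.zero_apply, Pi.neg_apply] at h1 h2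
    omega
  have hd : ∀ x ∈ l, ∀ y ∈ m, ∀ i, x i = 0 ∨ y i = 0 := fun x hx y hy i ↦
    (le_total (d i) 0).imp (h1 x hx i) (h2 y hy i)
  refine ⟨l ++ m.map (-·), ?_, ?_, ?_, ?_⟩
  · simp only [List.mem_append, List.mem_map]
    rintro _ (hx | ⟨x, hx, rfl⟩)
    · exact (hl _ hx).2
    · simpa using (hm _ hx).2
  · simp only [List.mem_append, List.mem_map]
    rintro _ (hx | ⟨x, hx, rfl⟩) i hi
    · exact h1 _ hx i hi.le
    · simpa using h2 _ hx i hi.ge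
  · simp only [List.mem_append, List.mem_map]
    rintro _ (hx | ⟨x, hx, rfl⟩) _ (hy | ⟨y, hy, rfl⟩)
    · exact hl' _ hx _ hy
    · simpa using hB.apply_nonpos_of_disjoint (hl _ hx).1 (hm _ hy).1 (hd _ hx _ hy)
    · simpa using hB.apply_nonpos_of_disjoint (hm _ hx).1 (hl _ hy).1
        fun i ↦ (hd _ hy _ hx i).symm
    · simpa using hm' _ hx _ hy
  · have : (m.map (-·)).sum = -m.sum := by
      rw [← List.sum_neg]
    rw [List.sum_append, this, hsum, hsum']
    ext i
    simp only [Pi.add_apply, Pi.sup_apply, Pi.neg_apply, Pi.zero_apply]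
    omega

end Decomposition

/-! ### Refining a pair that violates the conclusion. -/

section Refinement

variable {I : Type*} [DecidableEq I] [Fintype I] {B : BilinForm ℤ (I → ℤ)}

/-- In coordinates making `γ` the simple root at a sink, its right perpendicular is a coordinate
hyperplane, and the decomposition preserves vanishing coordinates. -/
lemma IsEulerForm.exists_perp_decomposition (hB : IsEulerForm B) {γ : I → ℤ}
    (hγ : IsPosRoot B γ) {ν : I → ℤ} (hν : B γ ν = 0) :
    ∃ l : List (I → ℤ), (∀ x ∈ l, B x x = 1) ∧ (∀ x ∈ l, B γ x = 0) ∧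
      (∀ x ∈ l, ∀ y ∈ l, 0 ≤ B x y) ∧ l.sum = ν := by
  obtain ⟨B', k, f, hB', hk, hf, hfk⟩ := hB.isTail.exists_linearEquiv hγ
  have hγf : ∀ v, B γ (f v) = v k := fun v ↦ by
    rw [← hfk, hf, hk.apply_single_left hB']
  obtain ⟨l, h1, h2, h3, h4⟩ := hB'.exists_decomposition (f.symm ν)
  have h0 : f.symm ν k = 0 := by simpa [hν] using (hγf (f.symm ν)).symm
  refine ⟨l.map f, ?_, ?_, ?_, ?_⟩
  · simpa [hf] using h1
  · simpa [hγf] using fun x hx ↦ h2 x hx k h0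
  · simpa [hf] using h3
  · rw [← map_list_sum, h4, f.apply_symm_apply]

lemma IsEulerForm.exists_intermediate (hB : IsEulerForm B) {α β : I → ℤ} (hα : B α α = 1)
    (hβ : B β β = 1) (hγ : IsPosRoot B (α + β)) (hpos : 0 < B β α) :
    ∃ y, B y y = 1 ∧ B y (α + β) + B (α + β) y = 1 ∧ y ≠ α ∧ y ≠ β ∧
      0 < B β y ∧ B β y < B β (α + β) ∧ 0 < B y α ∧ B y α < B (α + β) α := by
  set h := B β α with hh
  have hαβ : B α β = -(h + 1) := by
    have := hγ.2
    simp only [map_add, LinearMap.add_apply] at this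
    omega
  -- The coefficient `h` is forced by B γ β = 1 - (h + 1) = -h.
  obtain ⟨l, h1, h2, h3, h4⟩ := hB.exists_perp_decomposition hγ (ν := β + h • (α + β)) (by
    simp only [map_add, map_smul, LinearMap.add_apply, smul_eq_mul, hα, hβ, hαβ, ← hh]; ring)
  have hm : ∀ y ∈ l, B β y = (l.map (B.flip y)).sum := fun y hy ↦ by
    rw [← map_list_sum, h4, LinearMap.BilinForm.flip_apply]
    simp only [map_add, map_smul, LinearMap.add_apply, LinearMap.smul_apply, smul_eq_mul]
    have := h2 y hy
    simp only [map_add, LinearMap.add_apply] at this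
    rw [this]; ring
  have hm1 : ∀ y ∈ l, 1 ≤ B β y := fun y hy ↦ by
    rw [hm y hy, ← h1 y hy]
    exact List.single_le_sum (by simpa using fun x hx ↦ h3 x hx y hy) _
      (List.mem_map_of_mem (f := B.flip y) hy)
  have hne : ∀ y ∈ l, y ≠ α ∧ y ≠ β ∧ y ≠ α + β := fun y hy ↦ by
    have hy0 := h2 y hy
    refine ⟨?_, ?_, ?_⟩ <;> rintro rfl <;>
      simp only [map_add, LinearMap.add_apply] at hy0 <;> omega
  -- Averaging: the difference of the two sides is linear in `y`, and on the whole sum it equals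
  -- -(h² + h + 1) < 0.
  obtain ⟨y, hy, hlt⟩ : ∃ y ∈ l,
      B β y < h * (B y (α + β) + B (α + β) y) + (B y β + B β y) := by
    by_contra! hno
    let φ : (I → ℤ) →ₗ[ℤ] ℤ := B β - (h • (B.flip (α + β) + B (α + β)) + (B.flip β + B β))
    have hφ : 0 ≤ φ l.sum := by
      rw [map_list_sum]
      refine List.sum_nonneg ?_
      simp only [List.mem_map, forall_exists_index, and_imp, forall_apply_eq_imp_iff₂]
      intro y hy
      have := hno y hy
      simp only [φ, LinearMap.sub_apply, LinearMap.add_apply, LinearMap.smul_apply,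
        LinearMap.BilinForm.flip_apply, smul_eq_mul]
      linarith
    rw [h4] at hφ
    simp only [φ, LinearMap.sub_apply, LinearMap.add_apply, LinearMap.smul_apply,
      LinearMap.BilinForm.flip_apply] at hφ
    simp only [LinearMap.add_apply, LinearMap.smul_apply, map_add, map_smul, smul_eq_mul, hα, hβ,
      hαβ, ← hh] at hφ
    nlinarith
  obtain ⟨hyα, hyβ, hyγ⟩ := hne y hy
  have a1 := hm1 y hy
  have a2 := hB.add_apply_le_one (h1 y hy) hβ hyβ
  have a3 := hB.add_apply_le_one (h1 y hy) hα hyα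
  have a4 := hB.add_apply_le_one (h1 y hy) hγ.2 hyγ
  -- Otherwise the `h`-term is nonpositive and 1 ≤ B β y < B y β + B β y ≤ 1.
  have a5 : B y (α + β) + B (α + β) y = 1 := by
    by_contra hne1
    nlinarith [show B y (α + β) + B (α + β) y ≤ 0 by omega]
  rw [a5, mul_one] at hlt
  have a6 := h2 y hy
  refine ⟨y, h1 y hy, a5, hyα, hyβ, a1, ?_, ?_, ?_⟩ <;>
    simp only [map_add, LinearMap.add_apply] at * <;> omega

theorem IsEulerForm.apply_eq_zero_of_isMinimalPair (hB : IsEulerForm B) {α β : I → ℤ}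
    (h : IsMinimalPair {v | IsPosRoot B v} (ARLt {v | IsPosRoot B v} fun v w ↦ B v w) α β) :
    B α β = -1 ∧ B β α = 0 := by
  obtain ⟨ρ, hρ⟩ := hB.isTail.exists_rank
  obtain ⟨hα, hβ, hlt, hγ, hmin⟩ := h
  change IsPosRoot B α at hα
  change IsPosRoot B β at hβ
  change IsPosRoot B (α + β) at hγ
  have rank_lt : ∀ x y, IsPosRoot B x → IsPosRoot B y → x ≠ y → 0 < B x y → ρ x < ρ y := by
    intro x y hx hy hne hxy
    have h1 := (hρ x hx y hy hne).1
    have h2 := (hρ y hy x hx hne.symm).2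
    by_contra h3
    have := (h2 (by omega)).2
    omega
  have rank_lt' : ∀ x y, IsPosRoot B x → IsPosRoot B y → B y x < 0 → ρ x < ρ y := by
    intro x y hx hy hxy
    have hne : x ≠ y := by rintro rfl; rw [hx.2] at hxy; omega
    have h1 := (hρ x hx y hy hne).1
    have h2 := (hρ y hy x hx hne.symm).2
    by_contra h3
    have := (h2 (by omega)).1
    omega
  -- Induction on the rank gap: an intermediate root blocking the arrow has rank strictly between.
  have path : ∀ n x y, IsPosRoot B x → IsPosRoot B y → x ≠ y → 0 < B x y → ρ y - ρ x = n →
      ARLt {v | IsPosRoot B v} (fun v w ↦ B v w) y x := by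
    intro n
    induction n using Nat.strong_induction_on with
    | _ n ih =>
      intro x y hx hy hne hxy hn
      by_cases harrow : ∀ z, IsPosRoot B z → 0 < B x z → 0 < B z y → z = x ∨ z = y
      · exact .single ⟨hx, hy, hne, hxy, harrow⟩
      push Not at harrow
      obtain ⟨z, hz, hxz, hzy, hzx, hzy'⟩ := harrow
      have l1 := rank_lt x z hx hz hzx.symm hxz
      have l2 := rank_lt z y hz hy hzy' hzy
      exact (ih _ (by omega) x z hx hz hzx.symm hxz rfl).trans
        (ih _ (by omega) z y hz hy hzy' hzy rfl)
  have hlt' : ρ β < ρ α := by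
    change Relation.TransGen _ _ _ at hlt
    clear hα hβ hγ hmin
    induction hlt with
    | single h => exact rank_lt _ _ h.1 h.2.1 h.2.2.1 h.2.2.2.1
    | tail _ h ih => exact ih.trans (rank_lt _ _ h.1 h.2.1 h.2.2.1 h.2.2.2.1)
  have hne : β ≠ α := by rintro rfl; exact lt_irrefl _ hlt'
  have hsign := (hρ β hβ α hα hne).2 hlt'
  have hsum : B α β + B β α = -1 := by
    have := hγ.2
    simp only [map_add, LinearMap.add_apply, hα.2, hβ.2] at this
    omega
  by_contra hcon
  have hpos : 0 < B β α := by omega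
  obtain ⟨y, hy, hyγ, hyα, hyβ, m1, m2, l1, l2⟩ :=
    hB.exists_intermediate hα.2 hβ.2 hγ hpos
  -- If `-z` were the positive root, it would rank before `β` and after `α`, although `β` ranks
  -- before `α`.
  have positive : ∀ z, B z z = 1 → 0 < B β z → 0 < B z α → IsPosRoot B z := by
    intro z hz hβz hzα
    refine (hB.isPosRoot_or_neg hz).resolve_right fun hneg ↦ ?_
    have h1 := rank_lt' (-z) β hneg hβ (by simpa using hβz)
    have h2 := rank_lt' α (-z) hα hneg (by simpa using hzα)
    omega
  obtain ⟨y', hy'⟩ : ∃ y', y + y' = α + β := ⟨α + β - y, by abel⟩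
  have e1 : y' = α + β - y := by rw [← hy']; abel
  have hyy' : B y y' + B y' y = -1 := by
    simp only [e1, map_sub, LinearMap.sub_apply]
    omega
  have hy'1 : B y' y' = 1 := by
    have := hγ.2
    rw [← hy'] at this
    simp only [map_add, LinearMap.add_apply] at this
    omega
  have m1' : 0 < B β y' := by simp only [e1, map_sub]; omega
  have l1' : 0 < B y' α := by simp only [e1, map_sub, LinearMap.sub_apply]; omega
  have hy'α : y' ≠ α := by
    rintro rfl
    exact hyβ (by simpa [add_comm] using hy')
  have hy'β : y' ≠ β := by
    rintro rfl
    exact hyα (by simpa using hy')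
  have py := positive y hy m1 l1
  have py' := positive y' hy'1 m1' l1'
  have key : ∀ x z, IsPosRoot B x → IsPosRoot B z → x + z = α + β → x ≠ α → x ≠ β → z ≠ α →
      z ≠ β → 0 < B β x → 0 < B z α → B x z + B z x = -1 → ρ x < ρ z → False := by
    intro x z hx hz hxz hxα hxβ hzα hzβ hβx hzα' hs hlt
    have hne : x ≠ z := by rintro rfl; exact lt_irrefl _ hlt
    have h1 := ((hρ x hx z hz hne).2 hlt).1
    have hx0 : x ≠ 0 := by rintro rfl; simpa using hx.2
    have hz0 : z ≠ 0 := by rintro rfl; simpa using hz.2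
    refine hmin ⟨z, hz, x, hx, path _ z α hz hα hzα hzα' rfl, ?_,
      path _ β x hβ hx hxβ.symm hβx rfl, by rw [add_comm, hxz]⟩
    rw [← hxz] at hγ
    -- The path from `x` to `z` goes through γ = x + z: both B x γ and B γ z equal 1 + B x z, which
    -- is positive since `x` has the smaller rank.
    refine (path _ x (x + z) hx hγ (by simpa using hz0) ?_ rfl).trans
      (path _ (x + z) z hγ hz (by simpa using hx0) ?_ rfl) <;>
    · simp only [map_add, LinearMap.add_apply, hx.2, hz.2]
      omega
  have hne' : y ≠ y' := by rintro rfl; omega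
  rcases lt_or_gt_of_ne (hρ y py y' py' hne').1 with hl | hl
  · exact key y y' py py' hy' hyα hyβ hy'α hy'β m1 l1' hyy' hl
  · exact key y' y py' py (by rw [add_comm, hy']) hy'α hy'β hyα hyβ m1' l1 (by omega) hl

end Refinement

/-! ### From the root system to the Euler form. -/

section RootSystem

open scoped Classical in
/-- The Euler form as a bilinear form. -/
noncomputable def eulerBilinForm {I : Type*} [Fintype I] (arrow : I → I → Prop) :
    BilinForm ℤ (I → ℤ) :=
  Matrix.toBilin' (1 - Matrix.of fun i j ↦ if arrow i j then 1 else 0)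

lemma eulerBilinForm_apply {I : Type*} [Fintype I] (arrow : I → I → Prop) (v w : I → ℤ) :
    eulerBilinForm arrow v w = eulerForm arrow v w := by
  classical
  simp only [eulerBilinForm, eulerForm, map_sub, LinearMap.sub_apply, Matrix.toBilin'_apply]
  congr 1
  · simp [Matrix.one_apply]
  · simp

open scoped Classical in
lemma eulerBilinForm_single {I : Type*} [Fintype I] [DecidableEq I] (arrow : I → I → Prop)
    (i j : I) : eulerBilinForm arrow (Pi.single i 1) (Pi.single j 1) =
      (if i = j then 1 else 0) - (if arrow i j then 1 else 0) := by
  rw [eulerBilinForm_apply, eulerForm]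
  congr 1
  · simp [Pi.single_apply, eq_comm]
  · rw [Finset.sum_eq_single i, Finset.sum_eq_single j] <;> simp +contextual

variable {ι R M N : Type*} [Field R] [CharZero R]
    [AddCommGroup M] [Module R M] [AddCommGroup N] [Module R N]
    {P : RootPairing ι R M N} {b : P.Base}

/-- The root lattice vector with given coordinates. -/
def rootCombination (b : P.Base) : (b.support → ℤ) →ₗ[ℤ] M :=
  Fintype.linearCombination ℤ (fun i : b.support ↦ P.root i)

omit [CharZero R] in
lemma rootCombination_apply (v : b.support → ℤ) :
    rootCombination b v = ∑ i : b.support, v i • P.root i := rfl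

lemma rootCombination_injective : Function.Injective (rootCombination b) :=
  linearIndependent_iff_injective_fintypeLinearCombination.mp
    (b.linearIndepOn_root.restrict_scalars' ℤ)

variable [Finite ι] [P.IsCrystallographic]

omit [Finite ι] in
lemma cartanMatrix_symm (hb : b.cartanMatrix.IsSimplyLaced) (i j : b.support) :
    b.cartanMatrix i j = b.cartanMatrix j i := by
  rcases eq_or_ne i j with rfl | hij
  · rfl
  have h := b.cartanMatrix_apply_eq_zero_iff_symm (i := i) (j := j)
  have h1 := hb hij
  have h2 := hb hij.symm
  omega

variable [DecidableEq ι]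

omit [Finite ι] in
lemma eulerBilinForm_single_add (hb : b.cartanMatrix.IsSimplyLaced) (Q : DynkinOrientation b)
    (i j : b.support) :
    eulerBilinForm Q.arrow (Pi.single i 1) (Pi.single j 1) +
      eulerBilinForm Q.arrow (Pi.single j 1) (Pi.single i 1) = b.cartanMatrix i j := by
  have h := Q.arrow_or_arrow_iff i j
  have h' := Q.asymm i j
  rw [eulerBilinForm_single, eulerBilinForm_single]
  rcases eq_or_ne i j with rfl | hij
  · simp only [ne_eq, not_true_eq_false, false_and, or_self, iff_false] at h
    simp [h]
  · have h1 := hb hij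
    by_cases h2 : Q.arrow i j <;> by_cases h3 : Q.arrow j i <;>
      simp_all [hij.symm, eq_comm]

omit [Finite ι] in
lemma eulerBilinForm_add_single (hb : b.cartanMatrix.IsSimplyLaced) (Q : DynkinOrientation b)
    (v : b.support → ℤ) (j : b.support) :
    eulerBilinForm Q.arrow v (Pi.single j 1) + eulerBilinForm Q.arrow (Pi.single j 1) v =
      ∑ i, v i * b.cartanMatrix i j := by
  rw [apply_eq_sum_left, apply_eq_sum_right, ← Finset.sum_add_distrib]
  simp_rw [← mul_add, eulerBilinForm_single_add hb Q]

omit [Finite ι] in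
lemma eulerBilinForm_self (hb : b.cartanMatrix.IsSimplyLaced) (Q : DynkinOrientation b)
    (v : b.support → ℤ) :
    2 * eulerBilinForm Q.arrow v v = ∑ i, ∑ j, v i * b.cartanMatrix i j * v j := by
  have h : 2 * eulerBilinForm Q.arrow v v = ∑ j, v j *
      (eulerBilinForm Q.arrow v (Pi.single j 1) + eulerBilinForm Q.arrow (Pi.single j 1) v) := by
    simp_rw [mul_add, Finset.sum_add_distrib]
    rw [← apply_eq_sum_left, ← apply_eq_sum_right, two_mul]
  simp_rw [h, eulerBilinForm_add_single hb Q, Finset.mul_sum]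
  rw [Finset.sum_comm]
  exact Finset.sum_congr rfl fun i _ ↦ Finset.sum_congr rfl fun j _ ↦ by ring

/-- The Cartan matrix is positive definite after scaling by a diagonal `d`. Symmetry makes `d`
constant along edges, so the form splits orthogonally over the level sets of `d`, and on each the
scaling is a positive constant. -/
lemma eulerBilinForm_pos [P.IsRootSystem] (hb : b.cartanMatrix.IsSimplyLaced)
    (Q : DynkinOrientation b) (v : b.support → ℤ) (hv : v ≠ 0) :
    0 < eulerBilinForm Q.arrow v v := by
  classical
  obtain ⟨d, hd, hpd⟩ := b.exists_cartanMatrix_mul_diagaonal_posDef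
  have hsymm : ∀ i j, b.cartanMatrix i j ≠ 0 → d i = d j := fun i j hij ↦ by
    have h := hpd.isHermitian.apply i j
    simp only [Matrix.mul_diagonal, star_trivial] at h
    rw [← cartanMatrix_symm hb i j] at h
    exact mul_left_cancel₀ hij h
  let c : ℤ → (b.support → ℤ) := fun t i ↦ if d i = t then v i else 0
  let A : (b.support → ℤ) → ℤ := fun u ↦ ∑ i, ∑ j, u i * b.cartanMatrix i j * u j
  have hA : ∀ t, 0 < t → c t ≠ 0 → 0 < A (c t) := fun t ht hc ↦ by
    have h := hpd.dotProduct_mulVec_pos hc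
    have e : star (c t) ⬝ᵥ (b.cartanMatrix * Matrix.diagonal d).mulVec (c t) = t * A (c t) := by
      simp only [A, dotProduct, Matrix.mulVec, Matrix.mul_diagonal, star_trivial, Finset.mul_sum]
      refine Finset.sum_congr rfl fun i _ ↦ Finset.sum_congr rfl fun j _ ↦ ?_
      by_cases hj : d j = t
      · rw [hj]; ring
      · simp [c, hj]
    rw [e] at h
    exact pos_of_mul_pos_right h ht.le
  have hsplit : A v = ∑ t ∈ Finset.univ.image d, A (c t) := by
    symm
    simp only [A]
    rw [Finset.sum_comm]
    refine Finset.sum_congr rfl fun i _ ↦ ?_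
    rw [Finset.sum_comm]
    refine Finset.sum_congr rfl fun j _ ↦ ?_
    rw [Finset.sum_eq_single (d i)]
    · by_cases hij : b.cartanMatrix i j = 0
      · simp [hij]
      · simp [c, hsymm i j hij]
    · intro t _ ht
      simp [c, ht.symm]
    · simp
  obtain ⟨i, hi⟩ := Function.ne_iff.mp hv
  have hAv : 0 < A v := by
    rw [hsplit]
    refine Finset.sum_pos' (fun t ht ↦ ?_) ⟨d i, Finset.mem_image_of_mem d (Finset.mem_univ i), ?_⟩
    · obtain ⟨j, -, rfl⟩ := Finset.mem_image.mp ht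
      by_cases hc : c (d j) = 0
      · simp [hc, A]
      · exact (hA _ (hd j) hc).le
    · exact hA _ (hd i) fun h ↦ hi (by simpa [c] using congrFun h i)
  have := eulerBilinForm_self hb Q v
  simp only [A] at hAv
  omega

omit [CharZero R] [Finite ι] [P.IsCrystallographic] in
lemma rootCombination_single (j : b.support) :
    rootCombination b (Pi.single j 1) = P.root j := by
  simp [rootCombination]

omit [Finite ι] in
lemma rootCombination_simpleReflection (hb : b.cartanMatrix.IsSimplyLaced)
    (Q : DynkinOrientation b) (v : b.support → ℤ) (j : b.support) :
    rootCombination b (simpleReflection (eulerBilinForm Q.arrow) j v) =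
      P.reflection j (rootCombination b v) := by
  have h : P.coroot' j (rootCombination b v) =
      ((∑ i, v i * b.cartanMatrix i j : ℤ) : R) := by
    rw [rootCombination_apply, map_sum, Int.cast_sum]
    refine Finset.sum_congr rfl fun i _ ↦ ?_
    have h1 : ((b.cartanMatrix i j : ℤ) : R) = P.pairing i j :=
      P.algebraMap_pairingIn ℤ (i : ι) (j : ι)
    rw [map_zsmul, Int.cast_mul, h1, ← zsmul_eq_mul]
    rfl
  rw [simpleReflection_apply, eulerBilinForm_add_single hb Q, map_sub, map_smul,
    rootCombination_single, P.reflection_apply, h, Int.cast_smul_eq_zsmul]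

lemma isPositiveForm_eulerBilinForm [P.IsRootSystem] (hb : b.cartanMatrix.IsSimplyLaced)
    (Q : DynkinOrientation b) : IsPositiveForm (eulerBilinForm Q.arrow) where
  diag i := by
    have h := eulerBilinForm_single_add hb Q i i
    rw [b.cartanMatrix_apply_same] at h
    omega
  offDiag i j hij := by
    rw [eulerBilinForm_single, if_neg hij]
    split_ifs <;> norm_num
  pos := eulerBilinForm_pos hb Q

lemma exists_eq_rootCombination [P.IsRootSystem] [P.IsReduced]
    (hb : b.cartanMatrix.IsSimplyLaced) (Q : DynkinOrientation b) (k : ι) :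
    ∃ v, P.root k = rootCombination b v ∧ eulerBilinForm Q.arrow v v = 1 := by
  have hB := isPositiveForm_eulerBilinForm hb Q
  refine b.induction_reflect k
    (p := fun k ↦ ∃ v, P.root k = rootCombination b v ∧ eulerBilinForm Q.arrow v v = 1)
    (fun i ↦ ?_) (fun i hi ↦ ?_) fun i j ↦ ?_
  · rintro ⟨v, hv, hv1⟩
    refine ⟨-v, ?_, by simpa⟩
    rw [P.root_reflectionPerm, P.reflection_apply_self, hv, map_neg]
  · exact ⟨Pi.single ⟨i, hi⟩ 1, (rootCombination_single ⟨i, hi⟩).symm, hB.diag _⟩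
  · rintro ⟨v, hv, hv1⟩ hj
    refine ⟨simpleReflection (eulerBilinForm Q.arrow) ⟨j, hj⟩ v, ?_, ?_⟩
    · rw [P.root_reflectionPerm, hv, rootCombination_simpleReflection hb Q]
    · rw [hB.apply_simpleReflection_self, hv1]

/-- Descent on height: the norm is positive, so some simple root in the support pairs positively
with `v`; reflecting in it subtracts that simple root once, until `v` is itself simple. -/
lemma rootCombination_mem_range_of_nonneg [P.IsRootSystem]
    (hb : b.cartanMatrix.IsSimplyLaced) (Q : DynkinOrientation b) {v : b.support → ℤ}
    (hv : 0 ≤ v) (hv1 : eulerBilinForm Q.arrow v v = 1) :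
    rootCombination b v ∈ Set.range P.root := by
  have hB := isPositiveForm_eulerBilinForm hb Q
  induction hn : (∑ i, v i).toNat using Nat.strong_induction_on generalizing v with
  | _ n ih =>
    set B := eulerBilinForm Q.arrow with hBdef
    obtain ⟨j, hj, hj'⟩ : ∃ j, 0 < v j ∧ 0 < B v (Pi.single j 1) + B (Pi.single j 1) v := by
      by_contra! hno
      have h : 2 * B v v =
          ∑ j, v j * (B v (Pi.single j 1) + B (Pi.single j 1) v) := by
        simp_rw [mul_add, Finset.sum_add_distrib]
        rw [← apply_eq_sum_left, ← apply_eq_sum_right, two_mul]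
      have h2 : ∑ j, v j * (B v (Pi.single j 1) + B (Pi.single j 1) v) ≤ 0 := by
        refine Finset.sum_nonpos fun j _ ↦ ?_
        rcases (hv j).eq_or_lt with h0 | h0
        · simp [← h0]
        · exact mul_nonpos_of_nonneg_of_nonpos h0.le (hno j h0)
      omega
    by_cases hvj : v = Pi.single j 1
    · exact ⟨j, by rw [hvj, rootCombination_single]⟩
    have h1 := hB.add_apply_le_one hv1 (hB.diag j) hvj
    have h2 : simpleReflection B j v = v - Pi.single j 1 := by
      rw [simpleReflection_apply, le_antisymm h1 hj', one_smul]
    have hnonneg : 0 ≤ simpleReflection B j v := by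
      intro i
      rw [h2]
      rcases eq_or_ne i j with rfl | hij
      · simpa using Int.sub_nonneg.mpr hj
      · simpa [hij] using hv i
    have hlt : (∑ i, (simpleReflection B j v) i).toNat < n := by
      have h3 : ∑ i, (simpleReflection B j v) i = ∑ i, v i - 1 := by
        simp [h2]
      have h4 : v j ≤ ∑ i, v i :=
        Finset.single_le_sum (fun i _ ↦ hv i) (Finset.mem_univ j)
      rw [h3]
      omega
    obtain ⟨k, hk⟩ := ih _ hlt hnonneg (by rw [hB.apply_simpleReflection_self, hv1]) rfl
    refine ⟨P.reflectionPerm j k, ?_⟩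
    rw [P.root_reflectionPerm, hk, ← rootCombination_simpleReflection hb Q,
      hB.simpleReflection_simpleReflection]

lemma isEulerForm_eulerBilinForm [P.IsRootSystem] (hb : b.cartanMatrix.IsSimplyLaced)
    (Q : DynkinOrientation b) : IsEulerForm (eulerBilinForm Q.arrow) where
  toIsPositiveForm := isPositiveForm_eulerBilinForm hb Q
  finite := by
    refine ((Set.finite_range P.root).preimage
      rootCombination_injective.injOn).subset fun v hv ↦ ?_
    rcases (isPositiveForm_eulerBilinForm hb Q).isPosRoot_or_neg hv with h | h
    · exact rootCombination_mem_range_of_nonneg hb Q h.1 h.2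
    · obtain ⟨k, hk⟩ := rootCombination_mem_range_of_nonneg hb Q h.1 h.2
      refine ⟨P.reflectionPerm k k, ?_⟩
      rw [P.root_reflectionPerm, P.reflection_apply_self, hk, map_neg, neg_neg]

lemma positiveRoots_eq [P.IsRootSystem] [P.IsReduced] (hb : b.cartanMatrix.IsSimplyLaced)
    (Q : DynkinOrientation b) :
    positiveRoots b = {v | IsPosRoot (eulerBilinForm Q.arrow) v} := by
  ext v
  refine and_congr_right fun hv ↦ ⟨?_, fun hv1 ↦ ?_⟩
  · rintro ⟨k, hk⟩
    obtain ⟨w, hw, hw1⟩ := exists_eq_rootCombination hb Q k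
    rwa [rootCombination_injective (hw.symm.trans hk)] at hw1
  · exact rootCombination_mem_range_of_nonneg hb Q hv hv1

end RootSystem

end ARMinimal

theorem mainTheorem2 {ι R M N : Type*} [Finite ι] [Field R] [CharZero R]
    [AddCommGroup M] [Module R M] [AddCommGroup N] [Module R N]
    (P : RootPairing ι R M N) [P.IsRootSystem] [P.IsCrystallographic] [P.IsReduced]
    (b : P.Base) (hb : b.cartanMatrix.IsSimplyLaced)
    (Q : ARMinimal.DynkinOrientation b) (α β : b.support → ℤ)
    (h : ARMinimal.IsMinimalPair (ARMinimal.positiveRoots b)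
      (ARMinimal.ARLt (ARMinimal.positiveRoots b) (ARMinimal.eulerForm Q.arrow)) α β) :
    ARMinimal.eulerForm Q.arrow α β = -1 ∧ ARMinimal.eulerForm Q.arrow β α = 0 := by
  classical
  have he : ARMinimal.eulerForm Q.arrow =
      fun v w ↦ ARMinimal.eulerBilinForm Q.arrow v w := by
    funext v w
    rw [ARMinimal.eulerBilinForm_apply]
  rw [ARMinimal.positiveRoots_eq hb Q, he] at h
  rw [he]
  exact (ARMinimal.isEulerForm_eulerBilinForm hb Q).apply_eq_zero_of_isMinimalPair h
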